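/- All rings are associative with identity, not necessarily commutative. Let $R$ be an Iwanaga–Gorenstein ring, that is, a left and right Noetherian ring such that both ${}_RR$ and $R_R$ have finite injective dimension. Write $\operatorname{Mod} R$ and $\operatorname{Mod} R^{op}$ for the categories of left and of right $R$-modules, and $(-)^+=\operatorname{Hom}_{\mathbb Z}(-,\mathbb Q/\mathbb Z)$ for the character dual, which sends left $R$-modules to right $R$-modules. A (left or right) $R$-module $M$ is *Gorenstein injective* if there is an exact sequence $\cdots\to I_1\to I_0\to I^0\to I^1\to\cdots$ of injective modules (on the same side) with $M\cong\operatorname{Im}(I_0\to I^0)$ which stays exact under $\operatorname{Hom}_R(I,-)$ for every injective module $I$ on the same side. A left $R$-module $M$ is *Gorenstein flat* if there is an exact sequence $\cdots\to F_1\to F_0\to F^0\to F^1\to\cdots$ of flat left $R$-modules with $M\cong\operatorname{Im}(F_0\to F^0)$ which stays exact under $I\otimes_R-$ for every injective right $R$-module $I$; Gorenstein flat right $R$-modules are defined symmetrically, with $-\otimes_R I$ for every injective left $R$-module $I$. For a class $\mathcal C$ of modules, a homomorphism $f:C\to D$ with $C\in\mathcal C$ is a *$\mathcal C$-precover* of $D$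 if every homomorphism $g:C'\to D$ with $C'\in\mathcal C$ has the form $g=fh$ for some $h:C'\to C$; dually, a homomorphism $f:A\to C$ with $C\in\mathcal C$ is a *$\mathcal C$-preenvelope* of $A$ if every homomorphism $g:A\to C'$ with $C'\in\mathcal C$ has the form $g=hf$ for some $h:C\to C'$. When $\mathcal C$ is the class of Gorenstein injective (Gorenstein flat) modules one speaks of Gorenstein injective (Gorenstein flat) precovers and preenvelopes. **Corollary 3.4.** (1) If a monomorphism $f:A\to Q$ in $\operatorname{Mod} R$ is a Gorenstein injective preenvelope of $A$, then $f^+:Q^+\to A^+$ is surjective and is a Gorenstein flat precover of $A^+$ in $\operatorname{Mod} R^{op}$. (2) If a homomorphism $f:A\to G$ in $\operatorname{Mod} R$ is a Gorenstein flat preenvelope of $A$, then $f^+:G^+\to A^+$ is a Gorenstein injective precover of $A^+$ in $\operatorname{Mod} R^{op}$. -/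

import Mathlib

open CategoryTheory
open scoped TensorProduct

/-! Left `R`-modules are `Module R M`; right `R`-modules are `Module Rᵐᵒᵖ M`, with
`m · r = MulOpposite.op r • m`.  `ModuleCat Rᵐᵒᵖ` is the category of right `R`-modules. -/

universe u

namespace GorDual

/-! ### Tensor product over a noncommutative ring -/

section Tensor

variable (R : Type u) [Ring R]

/-- The subgroup of `M ⊗_ℤ N` generated by the elements `(m · r) ⊗ n - m ⊗ (r • n)`. -/
def balancedRel (M N : Type u) [AddCommGroup M] [Module Rᵐᵒᵖ M] [AddCommGroup N] [Module R N] :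
    AddSubgroup (M ⊗[ℤ] N) :=
  AddSubgroup.closure
    {t | ∃ (m : M) (r : R) (n : N), t = (MulOpposite.op r • m) ⊗ₜ[ℤ] n - m ⊗ₜ[ℤ] (r • n)}

/-- The abelian group `M ⊗_R N`, for a right `R`-module `M` and a left `R`-module `N`. -/
abbrev BalancedTensor (M N : Type u) [AddCommGroup M] [Module Rᵐᵒᵖ M]
    [AddCommGroup N] [Module R N] : Type u :=
  (M ⊗[ℤ] N) ⧸ balancedRel R M N

variable {R}
variable {M M' N N' : Type u} [AddCommGroup M] [Module Rᵐᵒᵖ M] [AddCommGroup M'] [Module Rᵐᵒᵖ M']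
  [AddCommGroup N] [Module R N] [AddCommGroup N'] [Module R N']

/-- The homomorphism `f ⊗_ℤ g` of abelian groups. -/
noncomputable def intTensorMap (f : M →ₗ[Rᵐᵒᵖ] M') (g : N →ₗ[R] N') :
    M ⊗[ℤ] N →+ M' ⊗[ℤ] N' :=
  (TensorProduct.map f.toAddMonoidHom.toIntLinearMap
    g.toAddMonoidHom.toIntLinearMap).toAddMonoidHom

theorem intTensorMap_tmul (f : M →ₗ[Rᵐᵒᵖ] M') (g : N →ₗ[R] N') (m : M) (n : N) :
    intTensorMap f g (m ⊗ₜ[ℤ] n) = f m ⊗ₜ[ℤ] g n := rfl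

theorem balancedRel_le_comap (f : M →ₗ[Rᵐᵒᵖ] M') (g : N →ₗ[R] N') :
    balancedRel R M N ≤ (balancedRel R M' N').comap (intTensorMap f g) := by
  refine (AddSubgroup.closure_le _).2 ?_
  rintro _ ⟨m, r, n, rfl⟩
  refine AddSubgroup.subset_closure ⟨f m, r, g n, ?_⟩
  simp [intTensorMap_tmul]

/-- The homomorphism `f ⊗_R g : M ⊗_R N → M' ⊗_R N'`. -/
noncomputable def BalancedTensor.map (f : M →ₗ[Rᵐᵒᵖ] M') (g : N →ₗ[R] N') :
    BalancedTensor R M N →+ BalancedTensor R M' N' :=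
  QuotientAddGroup.map _ _ (intTensorMap f g) (balancedRel_le_comap f g)

theorem BalancedTensor.map_mk_tmul (f : M →ₗ[Rᵐᵒᵖ] M') (g : N →ₗ[R] N') (m : M) (n : N) :
    BalancedTensor.map f g (QuotientAddGroup.mk (m ⊗ₜ[ℤ] n)) =
      QuotientAddGroup.mk (f m ⊗ₜ[ℤ] g n) := rfl

end Tensor

/-! ### Flat modules -/

section Flat

variable (R : Type u) [Ring R]

/-- The left `R`-module `N` is flat: `- ⊗_R N` preserves monomorphisms of right modules. -/
def LeftFlat (N : Type u) [AddCommGroup N] [Module R N] : Prop :=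
  ∀ (M M' : Type u) [AddCommGroup M] [AddCommGroup M'] [Module Rᵐᵒᵖ M] [Module Rᵐᵒᵖ M']
    (f : M →ₗ[Rᵐᵒᵖ] M'), Function.Injective f →
      Function.Injective (BalancedTensor.map f (LinearMap.id : N →ₗ[R] N))

/-- The right `R`-module `M` is flat: `M ⊗_R -` preserves monomorphisms of left modules. -/
def RightFlat (M : Type u) [AddCommGroup M] [Module Rᵐᵒᵖ M] : Prop :=
  ∀ (N N' : Type u) [AddCommGroup N] [AddCommGroup N'] [Module R N] [Module R N']
    (g : N →ₗ[R] N'), Function.Injective g →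
      Function.Injective (BalancedTensor.map (LinearMap.id : M →ₗ[Rᵐᵒᵖ] M) g)

end Flat

/-! ### Gorenstein injective and Gorenstein flat modules

Exact sequences are indexed cohomologically by `ℤ`, with differentials `d i : F i → F (i + 1)`;
the module in question is the image of `d 0 : F 0 → F 1`. -/

section Gorenstein

variable (R : Type u) [Ring R]

/-- Gorenstein injective left `R`-modules. -/
def GorensteinInjective : ObjectProperty (ModuleCat.{u} R) := fun M =>
  ∃ (F : ℤ → ModuleCat.{u} R) (d : ∀ i : ℤ, F i →ₗ[R] F (i + 1)),
    (∀ i, Module.Injective R (F i)) ∧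
    (∀ i, Function.Exact (d i) (d (i + 1))) ∧
    Nonempty (M ≃ₗ[R] LinearMap.range (d 0)) ∧
    ∀ (I : Type u) [AddCommGroup I] [Module R I], Module.Injective R I →
      ∀ i, Function.Exact (fun g : I →ₗ[R] F i => (d i).comp g)
        (fun g : I →ₗ[R] F (i + 1) => (d (i + 1)).comp g)

/-- Gorenstein flat left `R`-modules; the test functors are `I ⊗_R -` for injective right
`R`-modules `I`. -/
def LeftGorensteinFlat : ObjectProperty (ModuleCat.{u} R) := fun M =>
  ∃ (F : ℤ → ModuleCat.{u} R) (d : ∀ i : ℤ, F i →ₗ[R] F (i + 1)),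
    (∀ i, LeftFlat R (F i)) ∧
    (∀ i, Function.Exact (d i) (d (i + 1))) ∧
    Nonempty (M ≃ₗ[R] LinearMap.range (d 0)) ∧
    ∀ (I : Type u) [AddCommGroup I] [Module Rᵐᵒᵖ I], Module.Injective Rᵐᵒᵖ I →
      ∀ i, Function.Exact (BalancedTensor.map (LinearMap.id : I →ₗ[Rᵐᵒᵖ] I) (d i))
        (BalancedTensor.map (LinearMap.id : I →ₗ[Rᵐᵒᵖ] I) (d (i + 1)))

/-- Gorenstein flat right `R`-modules; the test functors are `- ⊗_R I` for injective left
`R`-modules `I`. -/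
def RightGorensteinFlat : ObjectProperty (ModuleCat.{u} Rᵐᵒᵖ) := fun M =>
  ∃ (F : ℤ → ModuleCat.{u} Rᵐᵒᵖ) (d : ∀ i : ℤ, F i →ₗ[Rᵐᵒᵖ] F (i + 1)),
    (∀ i, RightFlat R (F i)) ∧
    (∀ i, Function.Exact (d i) (d (i + 1))) ∧
    Nonempty (M ≃ₗ[Rᵐᵒᵖ] LinearMap.range (d 0)) ∧
    ∀ (I : Type u) [AddCommGroup I] [Module R I], Module.Injective R I →
      ∀ i, Function.Exact (BalancedTensor.map (d i) (LinearMap.id : I →ₗ[R] I))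
        (BalancedTensor.map (d (i + 1)) (LinearMap.id : I →ₗ[R] I))

/-- Iwanaga–Gorenstein rings: left and right Noetherian, with finite left and right
self-injective dimensions. -/
structure IsIwanagaGorenstein : Prop where
  left_noetherian : IsNoetherianRing R
  right_noetherian : IsNoetherianRing Rᵐᵒᵖ
  left_injdim : ∃ n : ℕ, HasInjectiveDimensionLE (ModuleCat.of R R) n
  right_injdim : ∃ n : ℕ, HasInjectiveDimensionLE (ModuleCat.of Rᵐᵒᵖ R) n

end Gorenstein

/-! ### Precovers and preenvelopes -/

section Covers

variable {S : Type u} [Ring S]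

/-- `f : X → D` is a `C`-precover of `D`. -/
def IsPrecover (C : ObjectProperty (ModuleCat.{u} S)) {X D : Type u} [AddCommGroup X]
    [AddCommGroup D] [Module S X] [Module S D] (f : X →ₗ[S] D) : Prop :=
  C (ModuleCat.of S X) ∧
    ∀ (X' : Type u) [AddCommGroup X'] [Module S X'], C (ModuleCat.of S X') →
      ∀ g : X' →ₗ[S] D, ∃ h : X' →ₗ[S] X, f.comp h = g

/-- `f : A → X` is a `C`-preenvelope of `A`. -/
def IsPreenvelope (C : ObjectProperty (ModuleCat.{u} S)) {A X : Type u} [AddCommGroup A]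
    [AddCommGroup X] [Module S A] [Module S X] (f : A →ₗ[S] X) : Prop :=
  C (ModuleCat.of S X) ∧
    ∀ (X' : Type u) [AddCommGroup X'] [Module S X'], C (ModuleCat.of S X') →
      ∀ g : A →ₗ[S] X', ∃ h : X →ₗ[S] X', h.comp f = g

end Covers

/-! ### Character modules

`CharacterModule A` is the group of additive maps `A → ℚ ⧸ ℤ`. -/

section Character

variable {R : Type u} [Ring R]

/-- The right `R`-module structure `(χ · r) a = χ (r • a)` on the character module of a left
`R`-module. -/
instance characterRightModule (A : Type u) [AddCommGroup A] [Module R A] :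
    Module Rᵐᵒᵖ (CharacterModule A) where
  smul r χ := AddMonoidHom.comp χ (DistribSMul.toAddMonoidHom A r.unop)
  one_smul χ := by
    ext a
    exact congrArg χ (one_smul R a)
  mul_smul r s χ := by
    ext a
    exact congrArg χ (mul_smul s.unop r.unop a)
  smul_zero _ := rfl
  smul_add _ _ _ := rfl
  add_smul r s χ := by
    ext a
    exact (congrArg χ (add_smul r.unop s.unop a)).trans (map_add χ _ _)
  zero_smul χ := by
    ext a
    exact (congrArg χ (zero_smul R a)).trans (map_zero χ)

theorem character_smul_apply {A : Type u} [AddCommGroup A] [Module R A] (r : Rᵐᵒᵖ)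
    (χ : CharacterModule A) (a : A) : (r • χ) a = χ (r.unop • a) := rfl

/-- The homomorphism of right `R`-modules `f⁺ : B⁺ → A⁺`, `χ ↦ χ ∘ f`. -/
def characterMap {A B : Type u} [AddCommGroup A] [AddCommGroup B] [Module R A] [Module R B]
    (f : A →ₗ[R] B) : CharacterModule B →ₗ[Rᵐᵒᵖ] CharacterModule A where
  toFun χ := AddMonoidHom.comp χ f.toAddMonoidHom
  map_add' _ _ := rfl
  map_smul' r χ := by
    ext a
    exact congrArg χ (f.map_smul r.unop a).symm

theorem characterMap_apply {A B : Type u} [AddCommGroup A] [AddCommGroup B] [Module R A]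
    [Module R B] (f : A →ₗ[R] B) (χ : CharacterModule B) (a : A) :
    characterMap f χ a = χ (f a) := rfl

end Character

end GorDual

namespace GorDual

/-! ### Characters of abelian groups -/

section Character

/-! The adjunction `Hom(M, A⁺) ≅ Hom(A, M⁺)` (`swap`, `unswap`) turns preenvelopes into precovers as
soon as `(-)⁺` exchanges the two classes of modules; this is `IsPreenvelope.isPrecover_dualMap`. If
`A` is Gorenstein flat, dualizing its flat complex gives injectives, and tensor-exactness becomes
exactness under `Hom(I, -)` (`GFlat.gorensteinInjective_dual`). If `A` is Gorenstein injective, the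
dual complex consists of flat modules, since over a Noetherian ring double duals of injectives are
injective (`injective_doubleDual`). It remains exact under tensoring with an injective `E` because
`E⁺` is a direct summand of the double dual of a free module. The free module has finite injective
dimension, and dimension shifting applies (`exists_factor_doubleDual`, `exists_factor_dual`,
`gFlat_dual`). Working over `σ : S ≃+* Rᵐᵒᵖ` lets one argument serve both sides: `opId R` dualizes
left modules, `flip (opId R)` right modules. -/

theorem exists_character_of_exact {A B C : Type u} [AddCommGroup A] [AddCommGroup B]
    [AddCommGroup C] {f : A →+ B} {g : B →+ C} (h : Function.Exact f g)
    (χ : B →+ AddCircle (1 : ℚ)) (hχ : ∀ a, χ (f a) = 0) :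
    ∃ ψ : C →+ AddCircle (1 : ℚ), ∀ b, ψ (g b) = χ b := by
  have hker : g.ker ≤ χ.ker := by
    intro b hb
    obtain ⟨a, rfl⟩ := (h b).1 hb
    exact hχ a
  -- As `ℚ/ℤ` is injective, the character induced on `B / ker g` extends along its embedding in `C`.
  obtain ⟨ψ, hψ⟩ := CharacterModule.dual_surjective_of_injective
    (QuotientAddGroup.kerLift g).toIntLinearMap (QuotientAddGroup.kerLift_injective g)
    (QuotientAddGroup.lift g.ker χ hker)
  exact ⟨ψ, fun b => DFunLike.congr_fun hψ (QuotientAddGroup.mk b)⟩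

theorem exists_character_of_injective {A B : Type u} [AddCommGroup A] [AddCommGroup B]
    {f : A →+ B} (h : Function.Injective f) (χ : A →+ AddCircle (1 : ℚ)) :
    ∃ ψ : B →+ AddCircle (1 : ℚ), ∀ a, ψ (f a) = χ a := by
  obtain ⟨ψ, hψ⟩ := CharacterModule.dual_surjective_of_injective f.toIntLinearMap h χ
  exact ⟨ψ, fun b => DFunLike.congr_fun hψ b⟩

theorem injective_of_exists_character {A B : Type u} [AddCommGroup A] [AddCommGroup B]
    {f : A →+ B}
    (h : ∀ χ : A →+ AddCircle (1 : ℚ), ∃ ψ : B →+ AddCircle (1 : ℚ), ∀ a, ψ (f a) = χ a) :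
    Function.Injective f := by
  refine (injective_iff_map_eq_zero f).2 fun a ha => ?_
  refine CharacterModule.eq_zero_of_character_apply fun χ => ?_
  obtain ⟨ψ, hψ⟩ := h χ
  exact (hψ a).symm.trans (by rw [ha, map_zero])

/-- Characters separate the points of `B / im f`, and each of them comes from a character of `B`
vanishing on `im f`, hence factors through `g`. -/
theorem exact_of_exists_character {A B C : Type u} [AddCommGroup A] [AddCommGroup B]
    [AddCommGroup C] {f : A →+ B} {g : B →+ C} (h0 : ∀ a, g (f a) = 0)
    (h : ∀ χ : B →+ AddCircle (1 : ℚ), (∀ a, χ (f a) = 0) →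
      ∃ ψ : C →+ AddCircle (1 : ℚ), ∀ b, ψ (g b) = χ b) :
    Function.Exact f g := by
  refine fun b => ⟨fun hb => ?_, ?_⟩
  · have : (QuotientAddGroup.mk b : B ⧸ f.range) = 0 := by
      refine CharacterModule.eq_zero_of_character_apply fun χ => ?_
      obtain ⟨ψ, hψ⟩ := h (AddMonoidHom.comp χ (QuotientAddGroup.mk' f.range)) fun a => by
        have : (QuotientAddGroup.mk' f.range) (f a) = 0 :=
          (QuotientAddGroup.eq_zero_iff _).2 ⟨a, rfl⟩
        exact (congrArg χ this).trans (map_zero χ)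
      exact (hψ b).symm.trans (by rw [hb, map_zero])
    exact (QuotientAddGroup.eq_zero_iff _).1 this
  · rintro ⟨a, rfl⟩
    exact h0 a

end Character

/-! ### Character duality between `R`-modules and modules over an opposite ring `S` -/

section Dual

/-- The opposite of an identification of `S` with the opposite ring of `R`. -/
def flip {R S : Type u} [Ring R] [Ring S] (σ : S ≃+* Rᵐᵒᵖ) : R ≃+* Sᵐᵒᵖ where
  toFun r := MulOpposite.op (σ.symm (MulOpposite.op r))
  invFun s := (σ s.unop).unop
  left_inv r := by simp
  right_inv s := by simp
  map_mul' r r' := by simp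
  map_add' r r' := by simp

variable {R S : Type u} [Ring R] [Ring S] (σ : S ≃+* Rᵐᵒᵖ)

theorem unop_flip_unop (s : S) : (flip σ (σ s).unop).unop = s := by simp [flip]

theorem unop_unop_flip (r : R) : (σ (flip σ r).unop).unop = r := by simp [flip]

/-- The character module of an `R`-module, as a module over `S ≃ Rᵐᵒᵖ`. -/
def Dual (_ : S ≃+* Rᵐᵒᵖ) (A : Type u) [AddCommGroup A] [Module R A] : Type u :=
  CharacterModule A

variable (A : Type u) [AddCommGroup A] [Module R A]

instance : AddCommGroup (Dual σ A) := inferInstanceAs (AddCommGroup (CharacterModule A))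

instance : FunLike (Dual σ A) A (AddCircle (1 : ℚ)) :=
  inferInstanceAs (FunLike (CharacterModule A) A (AddCircle (1 : ℚ)))

instance : AddMonoidHomClass (Dual σ A) A (AddCircle (1 : ℚ)) :=
  inferInstanceAs (AddMonoidHomClass (A →+ AddCircle (1 : ℚ)) A (AddCircle (1 : ℚ)))

instance : Module S (Dual σ A) :=
  Module.compHom (CharacterModule A) (σ : S →+* Rᵐᵒᵖ)

variable {σ A}

/-- A character, as an element of the dual module. -/
def Dual.of (χ : A →+ AddCircle (1 : ℚ)) : Dual σ A := χ

/-- The character underlying an element of the dual module. -/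
def Dual.hom (χ : Dual σ A) : A →+ AddCircle (1 : ℚ) := χ

@[simp] theorem Dual.of_apply (χ : A →+ AddCircle (1 : ℚ)) (a : A) :
    (Dual.of χ : Dual σ A) a = χ a := rfl

@[simp] theorem Dual.hom_apply (χ : Dual σ A) (a : A) : χ.hom a = χ a := rfl

@[simp] theorem Dual.add_apply (χ ψ : Dual σ A) (a : A) : (χ + ψ) a = χ a + ψ a := rfl

@[simp] theorem Dual.sub_apply (χ ψ : Dual σ A) (a : A) : (χ - ψ) a = χ a - ψ a := rfl

@[simp] theorem Dual.zero_apply (a : A) : (0 : Dual σ A) a = 0 := rfl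

@[simp] theorem Dual.smul_apply (s : S) (χ : Dual σ A) (a : A) :
    (s • χ) a = χ ((σ s).unop • a) := rfl

@[ext] theorem Dual.ext {χ ψ : Dual σ A} (h : ∀ a, χ a = ψ a) : χ = ψ :=
  DFunLike.ext _ _ h

/-- Evaluation of characters at an element. -/
def Dual.evalHom (a : A) : Dual σ A →+ AddCircle (1 : ℚ) where
  toFun χ := χ a
  map_zero' := rfl
  map_add' _ _ := rfl

theorem Dual.sum_apply {ι : Type*} (s : Finset ι) (χ : ι → Dual σ A) (a : A) :
    (∑ i ∈ s, χ i) a = ∑ i ∈ s, χ i a :=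
  map_sum (Dual.evalHom a) χ s

theorem Dual.zsmul_apply (z : ℤ) (χ : Dual σ A) (a : A) : (z • χ) a = z • χ a :=
  map_zsmul (Dual.evalHom a) z χ

theorem Dual.eq_zero_of_forall {a : A} (h : ∀ χ : Dual σ A, χ a = 0) : a = 0 :=
  CharacterModule.eq_zero_of_character_apply h

variable {B C : Type u} [AddCommGroup B] [Module R B] [AddCommGroup C] [Module R C]

variable (σ) in
/-- The dual of a homomorphism. -/
def dualMap (f : A →ₗ[R] B) : Dual σ B →ₗ[S] Dual σ A where
  toFun χ := Dual.of (χ.hom.comp f.toAddMonoidHom)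
  map_add' _ _ := rfl
  map_smul' s χ := by
    ext a
    exact congrArg χ (f.map_smul (σ s).unop a).symm

@[simp] theorem dualMap_apply (f : A →ₗ[R] B) (χ : Dual σ B) (a : A) :
    dualMap σ f χ a = χ (f a) := rfl

theorem dualMap_comp (f : A →ₗ[R] B) (g : B →ₗ[R] C) :
    dualMap σ (g.comp f) = (dualMap σ f).comp (dualMap σ g) := rfl

theorem dualMap_injective {f : A →ₗ[R] B} (hf : Function.Surjective f) :
    Function.Injective (dualMap σ f) := by
  intro χ ψ h
  ext b
  obtain ⟨a, rfl⟩ := hf b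
  exact DFunLike.congr_fun h a

theorem dualMap_surjective {f : A →ₗ[R] B} (hf : Function.Injective f) :
    Function.Surjective (dualMap σ f) := by
  intro χ
  obtain ⟨ψ, hψ⟩ := exists_character_of_injective (f := f.toAddMonoidHom) hf χ.hom
  exact ⟨Dual.of ψ, Dual.ext hψ⟩

theorem dualMap_exact {f : A →ₗ[R] B} {g : B →ₗ[R] C} (h : Function.Exact f g) :
    Function.Exact (dualMap σ g) (dualMap σ f) := by
  refine fun χ => ⟨fun hχ => ?_, ?_⟩
  · obtain ⟨ψ, hψ⟩ := exists_character_of_exact (f := f.toAddMonoidHom) (g := g.toAddMonoidHom)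
      h χ.hom fun a => DFunLike.congr_fun hχ a
    exact ⟨Dual.of ψ, Dual.ext hψ⟩
  · rintro ⟨ψ, rfl⟩
    ext a
    rw [dualMap_apply, dualMap_apply, h.apply_apply_eq_zero, map_zero, Dual.zero_apply]

/-- The dual of the image of `g` is the image of the dual of `g`. -/
theorem nonempty_dual_equiv_range {g : B →ₗ[R] C} (e : A ≃ₗ[R] LinearMap.range g) :
    Nonempty (Dual σ A ≃ₗ[S] LinearMap.range (dualMap σ g)) := by
  set p : B →ₗ[R] A := e.symm.toLinearMap.comp g.rangeRestrict with hp
  set q : A →ₗ[R] C := (LinearMap.range g).subtype.comp e.toLinearMap with hq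
  have hg : g = q.comp p := by
    ext b
    simp [hp, hq]
  have hpi : Function.Injective (dualMap σ p) :=
    dualMap_injective (e.symm.surjective.comp g.surjective_rangeRestrict)
  have hqs : Function.Surjective (dualMap σ q) :=
    dualMap_surjective ((Submodule.injective_subtype _).comp e.injective)
  have hr : LinearMap.range (dualMap σ g) = LinearMap.range (dualMap σ p) := by
    rw [hg, dualMap_comp, LinearMap.range_comp, LinearMap.range_eq_top.2 hqs, Submodule.map_top]
  rw [hr]
  exact ⟨LinearEquiv.ofInjective _ hpi⟩

variable {M : Type u} [AddCommGroup M] [Module S M]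

/-- Homomorphisms `A → M⁺` give homomorphisms `M → A⁺`. -/
def swap (φ : A →ₗ[R] Dual (flip σ) M) : M →ₗ[S] Dual σ A where
  toFun m := Dual.of
    { toFun := fun a => φ a m
      map_zero' := by simp
      map_add' := by simp }
  map_add' m m' := by ext a; simp
  map_smul' s m := by
    ext a
    simp [unop_flip_unop]

/-- Homomorphisms `M → A⁺` give homomorphisms `A → M⁺`. -/
def unswap (φ : M →ₗ[S] Dual σ A) : A →ₗ[R] Dual (flip σ) M where
  toFun a := Dual.of
    { toFun := fun m => φ m a
      map_zero' := by simp
      map_add' := by simp }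
  map_add' m m' := by ext a; simp
  map_smul' r m := by
    ext a
    simp [unop_unop_flip]

@[simp] theorem unswap_apply (φ : M →ₗ[S] Dual σ A) (m : M) (a : A) :
    unswap φ a m = φ m a := rfl

variable (σ A) in
/-- The evaluation map into the double dual. -/
def toDoubleDual : A →ₗ[R] Dual (flip σ) (Dual σ A) := unswap LinearMap.id

@[simp] theorem toDoubleDual_apply (a : A) (χ : Dual σ A) : toDoubleDual σ A a χ = χ a := rfl

theorem toDoubleDual_injective : Function.Injective (toDoubleDual σ A) := by
  refine (injective_iff_map_eq_zero _).2 fun a ha => Dual.eq_zero_of_forall (σ := σ) fun χ => ?_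
  rw [← toDoubleDual_apply, ha, Dual.zero_apply]

end Dual

/-! ### Factorization lemmas, and direct sums of injectives over Noetherian rings -/

section Injective

variable {R S : Type u} [Ring R] [Ring S]

theorem exists_factor_of_injective {A B C E : Type u} [AddCommGroup A] [AddCommGroup B]
    [AddCommGroup C] [AddCommGroup E] [Module R A] [Module R B] [Module R C] [Module R E]
    (hE : Module.Injective R E) {f : A →ₗ[R] B} {g : B →ₗ[R] C} (h : Function.Exact f g)
    (φ : B →ₗ[R] E) (hφ : φ.comp f = 0) : ∃ ψ : C →ₗ[R] E, ψ.comp g = φ := by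
  have hker : LinearMap.ker g ≤ LinearMap.ker φ := by
    intro b hb
    obtain ⟨a, rfl⟩ := (h b).1 hb
    exact LinearMap.congr_fun hφ a
  obtain ⟨ψ, hψ⟩ := hE.out ((LinearMap.ker g).liftQ g le_rfl)
    (LinearMap.ker_eq_bot.1 (Submodule.ker_liftQ_eq_bot _ _ _ le_rfl))
    ((LinearMap.ker g).liftQ φ hker)
  exact ⟨ψ, LinearMap.ext fun b => hψ (Submodule.Quotient.mk b)⟩

theorem exists_factor_of_exact {A B C F : Type u} [AddCommGroup A] [AddCommGroup B]
    [AddCommGroup C] [AddCommGroup F] [Module R A] [Module R B] [Module R C] [Module R F]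
    {f : A →ₗ[R] B} {g : B →ₗ[R] C} (hf : Function.Injective f) (h : Function.Exact f g)
    (φ : F →ₗ[R] B) (hφ : g.comp φ = 0) : ∃ ψ : F →ₗ[R] A, f.comp ψ = φ := by
  have hr : ∀ x, φ x ∈ LinearMap.range f := fun x => (h _).1 (LinearMap.congr_fun hφ x)
  refine ⟨(LinearEquiv.ofInjective f hf).symm.toLinearMap.comp (φ.codRestrict _ hr), ?_⟩
  ext x
  exact congrArg Subtype.val ((LinearEquiv.ofInjective f hf).apply_symm_apply ⟨φ x, hr x⟩)

/-- Direct sums of copies of an injective module over a Noetherian ring are injective. -/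
theorem injective_finsupp [IsNoetherianRing R] (X : Type u) {M : Type u} [AddCommGroup M]
    [Module R M] (hM : Module.Injective R M) : Module.Injective R (X →₀ M) := by
  classical
  refine Module.Baer.injective fun J g => ?_
  obtain ⟨T, hT⟩ := (IsNoetherian.noetherian (⊤ : Submodule R J))
  have key : ∀ x, ∃ m : M, ∀ s : J, (s : R) • m = g s x := by
    intro x
    -- Baer's criterion in each coordinate separately: `g` followed by a coordinate is
    -- multiplication into some `m`.
    obtain ⟨h, hh⟩ := Module.Baer.of_injective hM J ((Finsupp.lapply x).comp g)
    refine ⟨h 1, fun s => ?_⟩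
    rw [← map_smul, smul_eq_mul, mul_one]
    exact hh s s.2
  choose m hm using key
  -- Only finitely many coordinates of `g` are nonzero, because `J` is finitely generated.
  have hfin : {x | (Finsupp.lapply x : (X →₀ M) →ₗ[R] M).comp g ≠ 0}.Finite := by
    refine (T.biUnion fun t => (g t).support).finite_toSet.subset fun x hx => ?_
    by_contra hn
    simp only [Finset.coe_biUnion, Set.mem_iUnion, Finset.mem_coe, Finsupp.mem_support_iff,
      not_exists, not_not] at hn
    exact hx (LinearMap.ext_on hT fun t ht => hn t ht)
  -- Where the coordinate of `g` vanishes the chosen `m x` may be nonzero, so it is replaced by `0`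
  -- to get finite support.
  let y : X →₀ M := Finsupp.onFinset hfin.toFinset
    (fun x => if (Finsupp.lapply x : (X →₀ M) →ₗ[R] M).comp g ≠ 0 then m x else 0) (by
      intro x hx
      simp only [Set.Finite.mem_toFinset, Set.mem_ofPred_eq]
      intro h
      simp [h] at hx)
  refine ⟨LinearMap.toSpanSingleton R _ y, fun s hs => ?_⟩
  ext x
  rw [LinearMap.toSpanSingleton_apply, Finsupp.smul_apply]
  by_cases h : (Finsupp.lapply x : (X →₀ M) →ₗ[R] M).comp g = 0
  · have : g ⟨s, hs⟩ x = 0 := LinearMap.congr_fun h ⟨s, hs⟩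
    simp [y, h, this]
  · have : y x = m x := by simp [y, h]
    rw [this]
    exact hm x ⟨s, hs⟩

end Injective

/-! ### Double duals of injective modules -/

section DoubleDual

variable {R S : Type u} [Ring R] [Ring S] {σ : S ≃+* Rᵐᵒᵖ}
variable {I : Type u} [AddCommGroup I] [Module R I]
  {N N' N'' : Type u} [AddCommGroup N] [Module R N] [AddCommGroup N'] [Module R N']
  [AddCommGroup N''] [Module R N'']

variable (I) in
/-- Precomposition with a homomorphism. -/
def precomp (f : N →ₗ[R] N') : (N' →ₗ[R] I) →+ (N →ₗ[R] I) where
  toFun h := h.comp f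
  map_zero' := LinearMap.zero_comp f
  map_add' _ _ := rfl

theorem precomp_exact (hI : Module.Injective R I) {f : N →ₗ[R] N'} {g : N' →ₗ[R] N''}
    (h : Function.Exact f g) : Function.Exact (precomp I g) (precomp I f) := by
  refine fun φ => ⟨fun hφ => exists_factor_of_injective hI h φ hφ, ?_⟩
  rintro ⟨ψ, rfl⟩
  exact LinearMap.ext fun x => (congrArg ψ (h.apply_apply_eq_zero x)).trans (map_zero ψ)

theorem compHom_exact {A B C : Type u} [AddCommGroup A] [AddCommGroup B] [AddCommGroup C]
    {f : A →+ B} {g : B →+ C} (h : Function.Exact f g) :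
    Function.Exact (AddMonoidHom.compHom' g : (C →+ AddCircle (1 : ℚ)) →+ _)
      (AddMonoidHom.compHom' f) := by
  refine fun χ => ⟨fun hχ => ?_, ?_⟩
  · obtain ⟨ψ, hψ⟩ := exists_character_of_exact h χ fun a => DFunLike.congr_fun hχ a
    exact ⟨ψ, AddMonoidHom.ext hψ⟩
  · rintro ⟨ψ, rfl⟩
    exact AddMonoidHom.ext fun a =>
      (congrArg ψ (h.apply_apply_eq_zero a)).trans (map_zero ψ)

/-- The character `h ↦ χ (h n)` of `Hom(N, I)`. -/
def evalCharacter (n : N) (χ : Dual σ I) : (N →ₗ[R] I) →+ AddCircle (1 : ℚ) where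
  toFun h := χ (h n)
  map_zero' := by simp
  map_add' := by simp

/-- The homomorphism `I → Hom(Rᵐ, I)` onto the `j`-th coordinate. -/
def coordHom {m : ℕ} (j : Fin m) : I →+ ((Fin m → R) →ₗ[R] I) where
  toFun x := (LinearMap.toSpanSingleton R I x).comp (LinearMap.proj j)
  map_zero' := by ext; simp
  map_add' _ _ := by ext; simp

theorem sum_coordHom {m : ℕ} (h : (Fin m → R) →ₗ[R] I) :
    ∑ j, coordHom j (h (Pi.single j 1)) = h := by
  ext i
  simp [coordHom, Pi.single_apply]

/-- Since `Hom(Rᵐ, I) ≅ Iᵐ`, its characters are sums of evaluation characters, so they can be tested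
on those. -/
theorem sum_evalCharacter {m : ℕ} (ξ : ((Fin m → R) →ₗ[R] I) →+ AddCircle (1 : ℚ)) :
    ∑ j, evalCharacter (Pi.single j 1) (Dual.of (ξ.comp (coordHom j)) : Dual σ I) = ξ := by
  ext h
  rw [AddMonoidHom.finsetSum_apply]
  conv_rhs => rw [← sum_coordHom h, map_sum]
  rfl

/-- This transports `Hom(Rᵐ, I⁺⁺)` into `Hom(Rᵐ, I)⁺⁺`, which is possible because `Rᵐ` is finite
free. -/
theorem exists_character_of_linearMap {m : ℕ}
    (y : (Fin m → R) →ₗ[R] Dual (flip σ) (Dual σ I)) :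
    ∃ Λ : (((Fin m → R) →ₗ[R] I) →+ AddCircle (1 : ℚ)) →+ AddCircle (1 : ℚ),
      ∀ v χ, Λ (evalCharacter v χ) = y v χ := by
  refine ⟨∑ j, { toFun := fun ξ => y (Pi.single j 1) (Dual.of (ξ.comp (coordHom j)))
                 map_zero' := map_zero (y (Pi.single j 1))
                 map_add' := fun ξ ξ' => map_add (y (Pi.single j 1))
                   (Dual.of (ξ.comp (coordHom j))) (Dual.of (ξ'.comp (coordHom j))) },
    fun v χ => ?_⟩
  have hv : v = ∑ j, v j • (Pi.single j 1 : Fin m → R) := by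
    ext i
    simp [Pi.single_apply]
  conv_rhs => rw [hv, map_sum, Dual.sum_apply]
  rw [AddMonoidHom.finsetSum_apply]
  refine Finset.sum_congr rfl fun j _ => ?_
  rw [map_smul, Dual.smul_apply]
  refine congrArg (y (Pi.single j 1)) ?_
  ext x
  rw [Dual.smul_apply, unop_unop_flip]
  rfl

/-- Over a Noetherian ring, the double character dual of an injective module is injective. -/
theorem injective_doubleDual [IsNoetherianRing R] (σ : S ≃+* Rᵐᵒᵖ) (hI : Module.Injective R I) :
    Module.Injective R (Dual (flip σ) (Dual σ I)) := by
  refine Module.Baer.injective fun J g => ?_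
  -- Noetherianity gives a finite presentation `Rˡ → Rᵐ → J → 0` of the ideal in Baer's criterion.
  obtain ⟨m, p, hp⟩ := Module.Finite.exists_fin' R J
  obtain ⟨l, q, hq⟩ := Module.Finite.exists_fin' R (LinearMap.ker p)
  set q' : (Fin l → R) →ₗ[R] (Fin m → R) := (LinearMap.ker p).subtype.comp q with hq'
  set r : (Fin m → R) →ₗ[R] R := J.subtype.comp p with hr
  have hpq : ∀ v, p (q' v) = 0 := fun v => (q v).2
  have hex : Function.Exact q' r := by
    refine fun v => ⟨fun hv => ?_, ?_⟩
    · obtain ⟨w, hw⟩ := hq ⟨v, Subtype.ext hv⟩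
      exact ⟨w, congrArg Subtype.val hw⟩
    · rintro ⟨w, rfl⟩
      exact congrArg Subtype.val (hpq w)
  obtain ⟨Λ, hΛ⟩ := exists_character_of_linearMap (g.comp p)
  -- `Hom(Rˡ, I)⁺ → Hom(Rᵐ, I)⁺ → Hom(R, I)⁺` is exact, and `Λ` kills the image of the first map
  -- because `p ∘ q' = 0`; so `Λ` factors through a character `Λ'` of `Hom(R, I)⁺`, which encodes
  -- the extension of `g` to `R`.
  obtain ⟨Λ', hΛ'⟩ := exists_character_of_exact (compHom_exact (precomp_exact hI hex)) Λ
    fun ξ => by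
      rw [← sum_evalCharacter (σ := σ) ξ, map_sum, map_sum]
      refine Finset.sum_eq_zero fun j _ => ?_
      refine (hΛ (q' (Pi.single j 1)) (Dual.of (ξ.comp (coordHom j)))).trans ?_
      rw [LinearMap.comp_apply, hpq, map_zero, Dual.zero_apply]
  refine ⟨
    { toFun := fun s => Dual.of
        { toFun := fun χ => Λ' (evalCharacter s χ)
          map_zero' := map_zero Λ'
          map_add' := fun χ χ' => map_add Λ' (evalCharacter s χ) (evalCharacter s χ') }
      map_add' := fun s t => Dual.ext fun χ => ?_
      map_smul' := fun s t => Dual.ext fun χ => ?_ }, fun s hs => ?_⟩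
  · refine (congrArg Λ' ?_).trans (map_add Λ' (evalCharacter s χ) (evalCharacter t χ))
    ext h
    exact (congrArg χ (map_add h s t)).trans (map_add χ _ _)
  · refine congrArg Λ' ?_
    ext h
    refine (congrArg χ (map_smul h s t)).trans ?_
    change _ = χ ((σ (flip σ s).unop).unop • h t)
    rw [unop_unop_flip]
  · obtain ⟨v, hv⟩ := hp ⟨s, hs⟩
    have hs' : s = r v := (congrArg Subtype.val hv).symm
    ext χ
    rw [← hv]
    refine Eq.trans ?_ (hΛ v χ)
    rw [← hΛ']
    refine congrArg Λ' ?_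
    rw [hs']
    rfl

theorem injective_doubleDual_flip [IsNoetherianRing S] (σ : S ≃+* Rᵐᵒᵖ) {M : Type u}
    [AddCommGroup M] [Module S M] (hM : Module.Injective S M) :
    Module.Injective S (Dual σ (Dual (flip σ) M)) :=
  injective_doubleDual (flip σ) hM

end DoubleDual

/-! ### Tensor-hom adjunction for characters, and flatness -/

section Tensor

variable {R : Type u} [Ring R] {M M' N N' : Type u}
  [AddCommGroup M] [Module Rᵐᵒᵖ M] [AddCommGroup N] [Module R N]
  [AddCommGroup M'] [Module Rᵐᵒᵖ M'] [AddCommGroup N'] [Module R N']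

/-- The class of `m ⊗ n` in `M ⊗_R N`. -/
def btmul (m : M) (n : N) : BalancedTensor R M N := QuotientAddGroup.mk (m ⊗ₜ[ℤ] n)

theorem btmul_smul (m : M) (r : R) (n : N) :
    (btmul (MulOpposite.op r • m) n : BalancedTensor R M N) = btmul m (r • n) := by
  refine sub_eq_zero.1 ?_
  exact (QuotientAddGroup.eq_zero_iff (N := balancedRel R M N)
    ((MulOpposite.op r • m) ⊗ₜ[ℤ] n - m ⊗ₜ[ℤ] (r • n))).2
    (AddSubgroup.subset_closure ⟨m, r, n, rfl⟩)

theorem BalancedTensor.hom_ext {P : Type*} [AddCommGroup P] {χ ψ : BalancedTensor R M N →+ P}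
    (h : ∀ m n, χ (btmul m n) = ψ (btmul m n)) : χ = ψ := by
  refine QuotientAddGroup.addMonoidHom_ext _ ?_
  refine AddMonoidHom.ext fun t => ?_
  induction t using TensorProduct.induction_on with
  | zero => rw [map_zero, map_zero]
  | tmul m n => exact h m n
  | add x y hx hy => rw [map_add, map_add, hx, hy]

/-- The identification of right modules with `Rᵐᵒᵖ`-modules. -/
abbrev opId (R : Type u) [Ring R] : Rᵐᵒᵖ ≃+* Rᵐᵒᵖ := RingEquiv.refl Rᵐᵒᵖ

/-- Characters of `M ⊗_R N` as homomorphisms `M → N⁺`. -/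
def curryCharacter (χ : BalancedTensor R M N →+ AddCircle (1 : ℚ)) :
    M →ₗ[Rᵐᵒᵖ] Dual (opId R) N where
  toFun m := Dual.of (χ.comp ((QuotientAddGroup.mk' (balancedRel R M N)).comp
    (TensorProduct.mk ℤ M N m).toAddMonoidHom))
  map_add' m m' := by
    ext n
    exact (congrArg (fun t => χ (QuotientAddGroup.mk' (balancedRel R M N) t))
      (TensorProduct.add_tmul m m' n)).trans (by simp)
  map_smul' r m := by
    ext n
    exact congrArg χ (btmul_smul m r.unop n)

theorem exists_curryCharacter_eq (φ : M →ₗ[Rᵐᵒᵖ] Dual (opId R) N) :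
    ∃ χ : BalancedTensor R M N →+ AddCircle (1 : ℚ), ∀ m n, χ (btmul m n) = φ m n := by
  let l : M ⊗[ℤ] N →+ AddCircle (1 : ℚ) :=
    TensorProduct.liftAddHom
      { toFun := fun m => (φ m).hom
        map_zero' := map_zero φ
        map_add' := map_add φ } (fun z m n => by
          change φ (z • m) n = φ m (z • n)
          rw [map_zsmul, map_zsmul, Dual.zsmul_apply])
  refine ⟨QuotientAddGroup.lift _ l ?_, fun m n => rfl⟩
  refine (AddSubgroup.closure_le _).2 ?_
  rintro _ ⟨m, r, n, rfl⟩
  change l _ = 0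
  rw [map_sub, sub_eq_zero]
  change φ (MulOpposite.op r • m) n = φ m (r • n)
  rw [map_smul]
  rfl

/-- Lambek's criterion: by `(M ⊗ N)⁺ ≅ Hom(N, M⁺)`, extending maps into `M⁺` along a monomorphism is
extending characters along the induced map of tensor products. -/
theorem rightFlat_iff : RightFlat R M ↔ Module.Injective R (Dual (flip (opId R)) M) := by
  constructor
  · refine fun h => ⟨fun N N' _ _ _ _ g hg φ => ?_⟩
    obtain ⟨χ, hχ⟩ := exists_curryCharacter_eq (swap φ)
    obtain ⟨ψ, hψ⟩ := exists_character_of_injective (h N N' g hg) χ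
    refine ⟨unswap (curryCharacter ψ), fun n => Dual.ext fun m => ?_⟩
    exact (hψ (btmul m n)).trans (hχ m n)
  · intro h N N' _ _ _ _ g hg
    refine injective_of_exists_character fun χ => ?_
    obtain ⟨φ, hφ⟩ := h.out g hg (unswap (curryCharacter χ))
    obtain ⟨ψ, hψ⟩ := exists_curryCharacter_eq (swap φ)
    refine ⟨ψ, DFunLike.congr_fun (f := ψ.comp (BalancedTensor.map LinearMap.id g))
      (BalancedTensor.hom_ext fun m n => ?_)⟩
    exact (hψ m (g n)).trans (DFunLike.congr_fun (hφ n) m)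

theorem leftFlat_iff : LeftFlat R N ↔ Module.Injective Rᵐᵒᵖ (Dual (opId R) N) := by
  constructor
  · refine fun h => ⟨fun M M' _ _ _ _ g hg φ => ?_⟩
    obtain ⟨χ, hχ⟩ := exists_curryCharacter_eq φ
    obtain ⟨ψ, hψ⟩ := exists_character_of_injective (h M M' g hg) χ
    refine ⟨curryCharacter ψ, fun m => Dual.ext fun n => ?_⟩
    exact (hψ (btmul m n)).trans (hχ m n)
  · intro h M M' _ _ _ _ g hg
    refine injective_of_exists_character fun χ => ?_
    obtain ⟨φ, hφ⟩ := h.out g hg (curryCharacter χ)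
    obtain ⟨ψ, hψ⟩ := exists_curryCharacter_eq φ
    refine ⟨ψ, DFunLike.congr_fun (f := ψ.comp (BalancedTensor.map g LinearMap.id))
      (BalancedTensor.hom_ext fun m n => ?_)⟩
    exact (hψ (g m) n).trans (DFunLike.congr_fun (hφ m) n)

variable {N'' M'' : Type u} [AddCommGroup N''] [Module R N''] [AddCommGroup M''] [Module Rᵐᵒᵖ M'']

/-- Characters detect exactness, and `(M ⊗ N)⁺ ≅ Hom(M, N⁺)` rewrites the dual of the tensored
sequence. The right side says only that kernels lie in images; `h0` supplies the reverse inclusion.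
-/
theorem map_id_left_exact_iff {f : N →ₗ[R] N'} {g : N' →ₗ[R] N''} (h0 : g.comp f = 0) :
    Function.Exact (BalancedTensor.map (LinearMap.id : M →ₗ[Rᵐᵒᵖ] M) f)
        (BalancedTensor.map (LinearMap.id : M →ₗ[Rᵐᵒᵖ] M) g) ↔
      ∀ φ : M →ₗ[Rᵐᵒᵖ] Dual (opId R) N', (dualMap (opId R) f).comp φ = 0 →
        ∃ ψ : M →ₗ[Rᵐᵒᵖ] Dual (opId R) N'', (dualMap (opId R) g).comp ψ = φ := by
  constructor
  · intro h φ hφ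
    obtain ⟨χ, hχ⟩ := exists_curryCharacter_eq φ
    obtain ⟨ψ, hψ⟩ := exists_character_of_exact h χ
      (DFunLike.congr_fun (f := χ.comp (BalancedTensor.map LinearMap.id f)) (g := 0)
        (BalancedTensor.hom_ext fun m n =>
          (hχ m (f n)).trans (DFunLike.congr_fun (LinearMap.congr_fun hφ m) n)))
    exact ⟨curryCharacter ψ, LinearMap.ext fun m => Dual.ext fun n =>
      (hψ (btmul m n)).trans (hχ m n)⟩
  · intro h
    refine exact_of_exists_character
      (DFunLike.congr_fun (f := (BalancedTensor.map LinearMap.id g).comp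
        (BalancedTensor.map LinearMap.id f)) (g := 0) (BalancedTensor.hom_ext fun m n => ?_))
      fun χ hχ => ?_
    · refine (congrArg (btmul m) (LinearMap.congr_fun h0 n)).trans ?_
      exact congrArg QuotientAddGroup.mk (TensorProduct.tmul_zero _ m)
    · obtain ⟨φ, hφ⟩ := h (curryCharacter χ)
        (LinearMap.ext fun m => Dual.ext fun n => hχ (btmul m n))
      obtain ⟨ψ, hψ⟩ := exists_curryCharacter_eq φ
      refine ⟨ψ, DFunLike.congr_fun (f := ψ.comp (BalancedTensor.map LinearMap.id g))
        (BalancedTensor.hom_ext fun m n => ?_)⟩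
      exact (hψ m (g n)).trans (DFunLike.congr_fun (LinearMap.congr_fun hφ m) n)

theorem map_id_right_exact_iff {f : M →ₗ[Rᵐᵒᵖ] M'} {g : M' →ₗ[Rᵐᵒᵖ] M''} (h0 : g.comp f = 0) :
    Function.Exact (BalancedTensor.map f (LinearMap.id : N →ₗ[R] N))
        (BalancedTensor.map g (LinearMap.id : N →ₗ[R] N)) ↔
      ∀ φ : N →ₗ[R] Dual (flip (opId R)) M', (dualMap (flip (opId R)) f).comp φ = 0 →
        ∃ ψ : N →ₗ[R] Dual (flip (opId R)) M'', (dualMap (flip (opId R)) g).comp ψ = φ := by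
  constructor
  · intro h φ hφ
    obtain ⟨χ, hχ⟩ := exists_curryCharacter_eq (swap φ)
    obtain ⟨ψ, hψ⟩ := exists_character_of_exact h χ
      (DFunLike.congr_fun (f := χ.comp (BalancedTensor.map f LinearMap.id)) (g := 0)
        (BalancedTensor.hom_ext fun m n =>
          (hχ (f m) n).trans (DFunLike.congr_fun (LinearMap.congr_fun hφ n) m)))
    exact ⟨unswap (curryCharacter ψ), LinearMap.ext fun n => Dual.ext fun m =>
      (hψ (btmul m n)).trans (hχ m n)⟩
  · intro h
    refine exact_of_exists_character
      (DFunLike.congr_fun (f := (BalancedTensor.map g LinearMap.id).comp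
        (BalancedTensor.map f LinearMap.id)) (g := 0) (BalancedTensor.hom_ext fun m n => ?_))
      fun χ hχ => ?_
    · refine (congrArg (fun x => btmul x n) (LinearMap.congr_fun h0 m)).trans ?_
      exact congrArg QuotientAddGroup.mk (TensorProduct.zero_tmul _ n)
    · obtain ⟨φ, hφ⟩ := h (unswap (curryCharacter χ))
        (LinearMap.ext fun n => Dual.ext fun m => hχ (btmul m n))
      obtain ⟨ψ, hψ⟩ := exists_curryCharacter_eq (swap φ)
      refine ⟨ψ, DFunLike.congr_fun (f := ψ.comp (BalancedTensor.map g LinearMap.id))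
        (BalancedTensor.hom_ext fun m n => ?_)⟩
      exact (hψ (g m) n).trans (DFunLike.congr_fun (LinearMap.congr_fun hφ n) m)

end Tensor

/-! ### Gorenstein flatness in terms of duals -/

section GorensteinFlat

/-- Gorenstein flatness, expressed through character duals. -/
def GFlat {R S : Type u} [Ring R] [Ring S] (σ : S ≃+* Rᵐᵒᵖ) : ObjectProperty (ModuleCat.{u} R) :=
  fun A => ∃ (F : ℤ → ModuleCat.{u} R) (d : ∀ i : ℤ, F i →ₗ[R] F (i + 1)),
    (∀ i, Module.Injective S (Dual σ (F i))) ∧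
    (∀ i, Function.Exact (d i) (d (i + 1))) ∧
    Nonempty (A ≃ₗ[R] LinearMap.range (d 0)) ∧
    ∀ (I : Type u) [AddCommGroup I] [Module S I], Module.Injective S I →
      ∀ i (φ : I →ₗ[S] Dual σ (F (i + 1))), (dualMap σ (d i)).comp φ = 0 →
        ∃ ψ : I →ₗ[S] Dual σ (F (i + 1 + 1)), (dualMap σ (d (i + 1))).comp ψ = φ

variable {R : Type u} [Ring R]

theorem leftGorensteinFlat_iff (A : ModuleCat.{u} R) :
    LeftGorensteinFlat R A ↔ GFlat (opId R) A := by
  refine exists_congr fun F => exists_congr fun d =>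
    and_congr (forall_congr' fun i => leftFlat_iff) (and_congr_right fun hd =>
      and_congr_right fun _ => ?_)
  refine forall_congr' fun I => forall_congr' fun _ => forall_congr' fun _ =>
    forall_congr' fun _ => forall_congr' fun i => ?_
  exact map_id_left_exact_iff (hd i).linearMap_comp_eq_zero

theorem rightGorensteinFlat_iff (A : ModuleCat.{u} Rᵐᵒᵖ) :
    RightGorensteinFlat R A ↔ GFlat (flip (opId R)) A := by
  refine exists_congr fun F => exists_congr fun d =>
    and_congr (forall_congr' fun i => rightFlat_iff) (and_congr_right fun hd =>
      and_congr_right fun _ => ?_)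
  refine forall_congr' fun I => forall_congr' fun _ => forall_congr' fun _ =>
    forall_congr' fun _ => forall_congr' fun i => ?_
  exact map_id_right_exact_iff (hd i).linearMap_comp_eq_zero

end GorensteinFlat

/-! ### Dimension shifting -/

section Vanishing

variable {R S : Type u} [Ring R] [Ring S] {σ : S ≃+* Rᵐᵒᵖ}

/-- Maps from a module with injective dual lift along the double dual of a surjection. -/
theorem exists_lift_doubleDual {F M N : Type u} [AddCommGroup F] [Module S F] [AddCommGroup M]
    [Module S M] [AddCommGroup N] [Module S N] (hF : Module.Injective R (Dual (flip σ) F))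
    {c : M →ₗ[S] N} (hc : Function.Surjective c) (θ : F →ₗ[S] Dual σ (Dual (flip σ) N)) :
    ∃ θ' : F →ₗ[S] Dual σ (Dual (flip σ) M),
      (dualMap σ (dualMap (flip σ) c)).comp θ' = θ := by
  -- By adjunction, lifting `θ` means extending a map `N⁺ → F⁺` along the embedding `N⁺ → M⁺`.
  obtain ⟨k, hk⟩ := hF.out (dualMap (flip σ) c) (dualMap_injective hc) (unswap θ)
  exact ⟨swap k, LinearMap.ext fun x => Dual.ext fun χ => DFunLike.congr_fun (hk χ) x⟩

/-- Any exact complex of modules with injective duals stays exact under `Hom` into the double dual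
of a direct sum of copies of a module of finite injective dimension. -/
theorem exists_factor_doubleDual [IsNoetherianRing S] {F : ℤ → ModuleCat.{u} S}
    {d : ∀ i : ℤ, F i →ₗ[S] F (i + 1)} (hd : ∀ i, Function.Exact (d i) (d (i + 1)))
    (hF : ∀ i, Module.Injective R (Dual (flip σ) (F i))) (X : Type u) (n : ℕ)
    (W : ModuleCat.{u} S) (hW : HasInjectiveDimensionLE W n) (i : ℤ)
    (φ : F (i + 1) →ₗ[S] Dual σ (Dual (flip σ) (X →₀ W))) (hφ : φ.comp (d i) = 0) :
    ∃ ψ : F (i + 1 + 1) →ₗ[S] Dual σ (Dual (flip σ) (X →₀ W)), ψ.comp (d (i + 1)) = φ := by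
  induction n generalizing W i with
  | zero =>
    have hW' : Module.Injective S W :=
      (Module.injective_iff_injective_object S W).2
        (injective_iff_hasInjectiveDimensionLT_one.2 hW)
    exact exists_factor_of_injective
      (injective_doubleDual_flip σ (injective_finsupp X hW')) (hd i) φ hφ
  | succ n ih =>
    let J : ModuleCat.{u} S := Injective.under W
    let ι : W →ₗ[S] J := (Injective.ι W).hom
    have hι : Function.Injective ι := (ModuleCat.mono_iff_injective (Injective.ι W)).1 inferInstance
    let C : ModuleCat.{u} S := ModuleCat.of S (J ⧸ LinearMap.range ι)
    let π : J →ₗ[S] C := (LinearMap.range ι).mkQ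
    have hπ : Function.Surjective π := Submodule.mkQ_surjective _
    have hιπ : Function.Exact ι π := LinearMap.exact_map_mkQ_range ι
    -- `HasInjectiveDimensionLE _ n` is `HasInjectiveDimensionLT _ (n + 1)`, hence the argument `n +
    -- 1`.
    have hC : HasInjectiveDimensionLE C n :=
      (ModuleCat.shortComplex_shortExact
        (ModuleCat.shortComplexOfCompEqZero ι π hιπ.linearMap_comp_eq_zero)
        hιπ hι hπ).hasInjectiveDimensionLT_X₃ (n + 1)
        (hasInjectiveDimensionLT_of_ge J 1 (n + 1) (by omega)) hW
    have hJ : Module.Injective S J :=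
      (Module.injective_iff_injective_object S J).2 (inferInstanceAs (Injective (Injective.under W)))
    let j : (X →₀ W) →ₗ[S] (X →₀ J) := Finsupp.mapRange.linearMap ι
    let c : (X →₀ J) →ₗ[S] (X →₀ C) := Finsupp.mapRange.linearMap π
    have hj : Function.Injective j := Finsupp.mapRange_injective ι (map_zero ι) hι
    have hc : Function.Surjective c := Finsupp.mapRange_surjective π (map_zero π) hπ
    have hjc : Function.Exact j c := by
      refine fun x => ⟨fun hx => ?_, ?_⟩
      · have : ∀ a, ∃ w, ι w = x a := fun a => (hιπ _).1 (DFunLike.congr_fun hx a)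
        choose w hw using this
        refine ⟨Finsupp.onFinset x.support w fun a ha => ?_, Finsupp.ext hw⟩
        rw [Finsupp.mem_support_iff, ← hw]
        exact fun h => ha (hι (h.trans (map_zero ι).symm))
      · rintro ⟨w, rfl⟩
        exact Finsupp.ext fun a => hιπ.apply_apply_eq_zero (w a)
    let a := dualMap σ (dualMap (flip σ) j)
    let b := dualMap σ (dualMap (flip σ) c)
    have ha : Function.Injective a := dualMap_injective (dualMap_surjective hj)
    have hab : Function.Exact a b := dualMap_exact (dualMap_exact hjc)
    have hba : b.comp a = 0 := hab.linearMap_comp_eq_zero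
    -- The double dual of `X →₀ J` is injective, so `φ` factors through `d (i + 1)` after being
    -- pushed there by `a`.
    obtain ⟨ψ', hψ'⟩ := exists_factor_of_injective
      (injective_doubleDual_flip σ (injective_finsupp X hJ)) (hd i) (a.comp φ)
      (by rw [LinearMap.comp_assoc, hφ, LinearMap.comp_zero])
    -- The obstruction `b ∘ ψ'` vanishes on the image of `d (i + 1)`, so induction applies one
    -- degree higher.
    obtain ⟨θ, hθ⟩ := ih C hC (i + 1) (b.comp ψ')
      ((congrArg b.comp hψ').trans
        (by rw [← LinearMap.comp_assoc, hba, LinearMap.zero_comp]))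
    obtain ⟨θ', hθ'⟩ := exists_lift_doubleDual (hF _) hc θ
    -- Subtracting the lifted `θ'` kills the obstruction, and does not affect the composite with `d
    -- (i + 1)` because `d ∘ d = 0`.
    obtain ⟨ψ, hψ⟩ := exists_factor_of_exact ha hab (ψ' - θ'.comp (d (i + 1 + 1))) (by
      rw [LinearMap.comp_sub, ← LinearMap.comp_assoc, hθ', hθ, sub_self])
    refine ⟨ψ, LinearMap.ext fun x => ha ?_⟩
    have h1 := LinearMap.congr_fun hψ (d (i + 1) x)
    have h2 : ψ' (d (i + 1) x) = a (φ x) := LinearMap.congr_fun hψ' x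
    have h3 : d (i + 1 + 1) (d (i + 1) x) = 0 := (hd (i + 1)).apply_apply_eq_zero x
    rw [LinearMap.sub_apply, LinearMap.comp_apply, LinearMap.comp_apply, h2, h3, map_zero,
      sub_zero] at h1
    exact h1

/-- If the Noetherian ring `S` has finite injective dimension over itself, then an exact complex of
modules with injective duals stays exact under `Hom` into the dual of an injective module. -/
theorem exists_factor_dual [IsNoetherianRing S] {W : ModuleCat.{u} S} (e : W ≃ₗ[S] S) {n : ℕ}
    (hW : HasInjectiveDimensionLE W n) {F : ℤ → ModuleCat.{u} S}
    {d : ∀ i : ℤ, F i →ₗ[S] F (i + 1)} (hd : ∀ i, Function.Exact (d i) (d (i + 1)))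
    (hF : ∀ i, Module.Injective R (Dual (flip σ) (F i))) {E : Type u} [AddCommGroup E]
    [Module R E] (hE : Module.Injective R E) (i : ℤ) (φ : F (i + 1) →ₗ[S] Dual σ E)
    (hφ : φ.comp (d i) = 0) :
    ∃ ψ : F (i + 1 + 1) →ₗ[S] Dual σ E, ψ.comp (d (i + 1)) = φ := by
  let p : (Dual σ E →₀ W) →ₗ[S] Dual σ E :=
    (Finsupp.linearCombination S id).comp (Finsupp.mapRange.linearMap e.toLinearMap)
  have hp : Function.Surjective p :=
    (Finsupp.linearCombination_surjective S Function.surjective_id).comp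
      (Finsupp.mapRange_surjective e (map_zero e) e.surjective)
  -- Dualizing the free cover `p` of `E⁺` embeds `E` in the dual of a free module; the embedding
  -- splits since `E` is injective, and dualizing again makes `E⁺` a summand of a double dual.
  let ι : E →ₗ[R] Dual (flip σ) (Dual σ E →₀ W) := (dualMap (flip σ) p).comp (toDoubleDual σ E)
  have hι : Function.Injective ι := (dualMap_injective hp).comp toDoubleDual_injective
  obtain ⟨ρ, hρ⟩ := hE.out ι hι LinearMap.id
  have hρι : (dualMap σ ι).comp (dualMap σ ρ) = LinearMap.id :=
    LinearMap.ext fun χ => Dual.ext fun x => congrArg χ (hρ x)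
  obtain ⟨ψ, hψ⟩ := exists_factor_doubleDual hd hF (Dual σ E) n W hW i ((dualMap σ ρ).comp φ)
    (by rw [LinearMap.comp_assoc, hφ, LinearMap.comp_zero])
  refine ⟨(dualMap σ ι).comp ψ, ?_⟩
  rw [LinearMap.comp_assoc, hψ, ← LinearMap.comp_assoc, hρι, LinearMap.id_comp]

end Vanishing

/-! ### Duals of complexes, and the exchange of the two Gorenstein classes -/

section DualComplex

variable {R S : Type u} [Ring R] [Ring S] (σ : S ≃+* Rᵐᵒᵖ)

/-- The differential of a complex, between indices that differ by one only propositionally. -/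
def diff {F : ℤ → ModuleCat.{u} R} (d : ∀ i : ℤ, F i →ₗ[R] F (i + 1)) (i j : ℤ)
    (h : i + 1 = j) : F i →ₗ[R] F j :=
  h ▸ d i

/-- The character dual of a complex, reindexed by `i ↦ 1 - i`. -/
abbrev dualObj (F : ℤ → ModuleCat.{u} R) (i : ℤ) : ModuleCat.{u} S :=
  ModuleCat.of S (Dual σ (F (1 - i)))

/-- The differential of the character dual of a complex. -/
def dualDiff {F : ℤ → ModuleCat.{u} R} (d : ∀ i : ℤ, F i →ₗ[R] F (i + 1)) (i : ℤ) :
    dualObj σ F i →ₗ[S] dualObj σ F (i + 1) :=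
  dualMap σ (diff d (1 - (i + 1)) (1 - i) (by ring))

variable {σ} {F : ℤ → ModuleCat.{u} R} {d : ∀ i : ℤ, F i →ₗ[R] F (i + 1)}

theorem diff_exact (hd : ∀ i, Function.Exact (d i) (d (i + 1))) {i j k : ℤ} (hij : i + 1 = j)
    (hjk : j + 1 = k) : Function.Exact (diff d i j hij) (diff d j k hjk) := by
  subst hij
  subst hjk
  exact hd i

theorem dualDiff_exact (hd : ∀ i, Function.Exact (d i) (d (i + 1))) (i : ℤ) :
    Function.Exact (dualDiff σ d i) (dualDiff σ d (i + 1)) :=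
  dualMap_exact (diff_exact hd _ _)

theorem nonempty_dual_equiv_range_dualDiff {A : ModuleCat.{u} R}
    (h : Nonempty (A ≃ₗ[R] LinearMap.range (d 0))) :
    Nonempty (Dual σ A ≃ₗ[S] LinearMap.range (dualDiff σ d 0)) := by
  have key : ∀ i j (hij : i + 1 = j), i = 0 →
      Nonempty (A ≃ₗ[R] LinearMap.range (diff d i j hij)) := by
    rintro i j rfl rfl
    exact h
  -- The reflection `i ↦ 1 - i` is chosen so that the dual differential at `0` is the dual of `d 0`.
  obtain ⟨e⟩ := key (1 - (0 + 1)) (1 - 0) (by ring) (by ring)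
  exact nonempty_dual_equiv_range e

variable {A : Type u} [AddCommGroup A] [Module R A]

theorem GFlat.gorensteinInjective_dual (h : GFlat σ (ModuleCat.of R A)) :
    GorensteinInjective S (ModuleCat.of S (Dual σ A)) := by
  obtain ⟨F, d, hF, hd, hA, hI⟩ := h
  refine ⟨dualObj σ F, dualDiff σ d, fun i => hF _, dualDiff_exact hd,
    nonempty_dual_equiv_range_dualDiff hA, fun I _ _ hinj i φ => ⟨fun hφ => ?_, ?_⟩⟩
  · have key : ∀ i j k (hij : i + 1 = j) (hjk : j + 1 = k) (φ : I →ₗ[S] Dual σ (F j)),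
        (dualMap σ (diff d i j hij)).comp φ = 0 →
        ∃ ψ : I →ₗ[S] Dual σ (F k), (dualMap σ (diff d j k hjk)).comp ψ = φ := by
      rintro i j k rfl rfl
      exact hI I hinj i
    exact key _ _ _ _ _ φ hφ
  · rintro ⟨ψ, rfl⟩
    exact LinearMap.ext fun x => (dualDiff_exact hd i).apply_apply_eq_zero (ψ x)

/-- `injective_doubleDual` makes the terms of the dual complex flat; finite self-injective dimension
of `S` gives the tensor condition through `exists_factor_dual`, after `swap` exchanges `Hom(I, F⁺)`
and `Hom(F, I⁺)`. -/
theorem gFlat_dual [IsNoetherianRing R] [IsNoetherianRing S] {W : ModuleCat.{u} S}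
    (e : W ≃ₗ[S] S) {n : ℕ} (hW : HasInjectiveDimensionLE W n)
    (h : GorensteinInjective R (ModuleCat.of R A)) :
    GFlat (flip σ) (ModuleCat.of S (Dual σ A)) := by
  obtain ⟨F, d, hF, hd, hA, -⟩ := h
  have hinj : ∀ i, Module.Injective R (Dual (flip σ) (dualObj σ F i)) :=
    fun i => injective_doubleDual σ (hF _)
  refine ⟨dualObj σ F, dualDiff σ d, hinj, dualDiff_exact hd,
    nonempty_dual_equiv_range_dualDiff hA, fun I _ _ hI i φ hφ => ?_⟩
  obtain ⟨ψ, hψ⟩ := exists_factor_dual e hW (dualDiff_exact hd) hinj hI i (swap φ)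
    (LinearMap.ext fun x => Dual.ext fun y => DFunLike.congr_fun (LinearMap.congr_fun hφ y) x)
  exact ⟨unswap ψ, LinearMap.ext fun y => Dual.ext fun x =>
    DFunLike.congr_fun (LinearMap.congr_fun hψ x) y⟩

end DualComplex

/-! ### From preenvelopes to precovers -/

section Precovers

variable {R S : Type u} [Ring R] [Ring S] {σ : S ≃+* Rᵐᵒᵖ}
  {A Q : Type u} [AddCommGroup A] [AddCommGroup Q] [Module R A] [Module R Q]

/-- If duality exchanges the classes `C` and `D`, then it takes `C`-preenvelopes to
`D`-precovers. -/
theorem IsPreenvelope.isPrecover_dualMap {C : ObjectProperty (ModuleCat.{u} R)}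
    {D : ObjectProperty (ModuleCat.{u} S)}
    (hCD : ∀ (X : Type u) [AddCommGroup X] [Module R X], C (ModuleCat.of R X) →
      D (ModuleCat.of S (Dual σ X)))
    (hDC : ∀ (X : Type u) [AddCommGroup X] [Module S X], D (ModuleCat.of S X) →
      C (ModuleCat.of R (Dual (flip σ) X)))
    {f : A →ₗ[R] Q} (hf : IsPreenvelope C f) : IsPrecover D (dualMap σ f) := by
  refine ⟨hCD Q hf.1, fun X _ _ hX g => ?_⟩
  -- The adjoint `A → X⁺` of `g` factors through `f`, as `X⁺` lies in `C`; the adjoint of the factor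
  -- is the required lift.
  obtain ⟨h, hh⟩ := hf.2 _ (hDC X hX) (unswap g)
  exact ⟨swap h, LinearMap.ext fun x => Dual.ext fun a =>
    DFunLike.congr_fun (LinearMap.congr_fun hh a) x⟩

end Precovers

end GorDual

theorem corollary3p4 (R : Type u) [Ring R] (hR : GorDual.IsIwanagaGorenstein R) :
    (∀ (A Q : Type u) [AddCommGroup A] [AddCommGroup Q] [Module R A] [Module R Q]
      (f : A →ₗ[R] Q), Function.Injective f →
        GorDual.IsPreenvelope (GorDual.GorensteinInjective R) f →
        Function.Surjective (GorDual.characterMap f) ∧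
          GorDual.IsPrecover (GorDual.RightGorensteinFlat R) (GorDual.characterMap f)) ∧
    (∀ (A G : Type u) [AddCommGroup A] [AddCommGroup G] [Module R A] [Module R G]
      (f : A →ₗ[R] G),
        GorDual.IsPreenvelope (GorDual.LeftGorensteinFlat R) f →
        GorDual.IsPrecover (GorDual.GorensteinInjective Rᵐᵒᵖ) (GorDual.characterMap f)) := by
  have := hR.left_noetherian
  have := hR.right_noetherian
  obtain ⟨n, hn⟩ := hR.left_injdim
  obtain ⟨m, hm⟩ := hR.right_injdim
  -- The dimension bound concerns `R` as a right module, while `gFlat_dual` asks for the regular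
  -- `Rᵐᵒᵖ`-module.
  let e : R ≃ₗ[Rᵐᵒᵖ] Rᵐᵒᵖ :=
    { MulOpposite.opAddEquiv with map_smul' := fun _ _ => rfl }
  refine ⟨fun A Q _ _ _ _ f hf hQ => ⟨GorDual.dualMap_surjective (σ := GorDual.opId R) hf, ?_⟩,
    fun A G _ _ _ _ f hG => ?_⟩
  · refine GorDual.IsPreenvelope.isPrecover_dualMap (σ := GorDual.opId R) (fun X _ _ hX => ?_)
      (fun X _ _ hX => ?_) hQ
    · exact (GorDual.rightGorensteinFlat_iff _).2 (GorDual.gFlat_dual e hm hX)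
    · exact ((GorDual.rightGorensteinFlat_iff _).1 hX).gorensteinInjective_dual
  · refine GorDual.IsPreenvelope.isPrecover_dualMap (σ := GorDual.opId R) (fun X _ _ hX => ?_)
      (fun X _ _ hX => ?_) hG
    · exact ((GorDual.leftGorensteinFlat_iff _).1 hX).gorensteinInjective_dual
    -- Here `R` and `Rᵐᵒᵖ` trade places, so the left self-injective dimension enters; `flip (flip
    -- (opId R))` agrees definitionally with `opId R`.
    · exact (GorDual.leftGorensteinFlat_iff _).2
        (GorDual.gFlat_dual (σ := GorDual.flip (GorDual.opId R)) (LinearEquiv.refl R R) hn hX)
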